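/- Let $C\ge 1$ and let $F_0:\mathbb R^d\to\{1,\dots,C\}$ be a (measurable) base classifier, $x_0\in\mathbb R^d$ an input with true class $y_0$, $\sigma>0$ and $P_{\mathsf{con}}\in(0,1)$. Notation. $\mathcal N(\sigma)=\mathcal N(0,\sigma^2 I_d)$. For an integer $k$ with $0\le k<d/2$ put $\sigma'=\sqrt{d/(d-2k)}\,\sigma$; the generalized Gaussian $\mathcal N^{g}(k,\sigma)$ is the distribution on $\mathbb R^d$ with density proportional to $\|\varepsilon\|_2^{-2k}\exp(-\|\varepsilon\|_2^2/(2\sigma'^2))$, and $\mathcal N^{g}_{\mathsf{trunc}}(k,T,\sigma)$ is the distribution with density proportional to $\|\varepsilon\|_2^{-2k}\exp(-\|\varepsilon\|_2^2/(2\sigma'^2))\,\mathbf 1[\|\varepsilon\|_2\le T]$. $\Gamma\mathrm{CDF}_{d/2}$ is the CDF of the gamma distribution with shape $d/2$ and rate $1$. For a distribution $\mathcal P$ on $\mathbb R^d$ and a measurable $F:\mathbb R^d\to\{1,\dots,C\}$ let $f_F^{\mathcal P}(x)_c=\Pr_{\varepsilon\sim\mathcal P}[F(x+\varepsilon)=c]$;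 the smoothed classifier $\widetilde F^{\mathcal P}$ predicts $\operatorname{argmax}_c f_F^{\mathcal P}(x)_c$ at $x$, and $\widetilde F^{\mathcal P}(x)=y$ means that $y$ is the unique maximizer. Concentration. $F_0$ satisfies $(\sigma,P_{\mathsf{con}})$-concentration at $x_0$ if $\Pr_{\varepsilon\sim\mathcal N(\sigma)}[F_0(x_0+\varepsilon)=y_0\mid\|\varepsilon\|_2\le T']=1$, where $T'$ satisfies $\Pr_{\varepsilon\sim\mathcal N(\sigma)}[\|\varepsilon\|_2\le T']=P_{\mathsf{con}}$. DSRS radius. For distributions $\mathcal P,\mathcal Q$ on $\mathbb R^d$, set $P_A=f_{F_0}^{\mathcal P}(x_0)_{y_0}$ and $Q_A=f_{F_0}^{\mathcal Q}(x_0)_{y_0}$. Then $r_{\mathsf{DSRS}}\in[0,\infty]$ is the largest $r$ such that every measurable $F:\mathbb R^d\to\{1,\dots,C\}$ with $f_F^{\mathcal P}(x_0)_{y_0}=P_A$ and $f_F^{\mathcal Q}(x_0)_{y_0}=Q_A$ satisfies $\widetilde F^{\mathcal P}(x)=y_0$ for all $x$ with $\|x-x_0\|_2<r$. Theorem. For every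 $P_{\mathsf{con}}\in(0,1)$ there is $d_0$, depending only on $P_{\mathsf{con}}$, such that for all $d\ge d_0$ and all $C,\sigma,F_0,x_0,y_0$ as above: if $F_0$ satisfies $(\sigma,P_{\mathsf{con}})$-concentration at $x_0$, then for every integer $k\ge 0$ with $d/2-15\le k<d/2$, taking $\mathcal P=\mathcal N^{g}(k,\sigma)$ and $\mathcal Q=\mathcal N^{g}_{\mathsf{trunc}}(k,T,\sigma)$ with $T=\sigma\sqrt{2\,\Gamma\mathrm{CDF}^{-1}_{d/2}(P_{\mathsf{con}})}$, one has $$r_{\mathsf{DSRS}}\ \ge\ 0.02\,\sigma\sqrt d .$$ -/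

import Mathlib

open MeasureTheory ProbabilityTheory
open scoped ENNReal

namespace DSRS

noncomputable section

/-- Input space `ℝ^d` with the Euclidean norm. -/
abbrev Input (d : ℕ) : Type := EuclideanSpace ℝ (Fin d)

/-- The distribution on `ℝ^d` whose Lebesgue density is proportional to `g`. -/
def distOfDensity {d : ℕ} (g : Input d → ℝ) : Measure (Input d) :=
  (∫⁻ ε, ENNReal.ofReal (g ε))⁻¹ • (volume.withDensity fun ε => ENNReal.ofReal (g ε))

/-- Isotropic Gaussian `N(σ) = N(0, σ² I_d)`. -/
def gaussian (d : ℕ) (σ : ℝ) : Measure (Input d) :=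
  distOfDensity fun ε => Real.exp (-‖ε‖ ^ 2 / (2 * σ ^ 2))

/-- `σ' = √(d / (d - 2k)) σ`. -/
def sigma' (d k : ℕ) (σ : ℝ) : ℝ :=
  Real.sqrt ((d : ℝ) / ((d : ℝ) - 2 * (k : ℝ))) * σ

/-- Unnormalized density `‖ε‖^(-2k) exp(-‖ε‖² / (2σ'²))`. -/
def genGaussianDensity (d k : ℕ) (σ : ℝ) (ε : Input d) : ℝ :=
  (‖ε‖ ^ (2 * k))⁻¹ * Real.exp (-‖ε‖ ^ 2 / (2 * sigma' d k σ ^ 2))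

/-- Generalized Gaussian `N^g(k, σ)`. -/
def genGaussian (d k : ℕ) (σ : ℝ) : Measure (Input d) :=
  distOfDensity (genGaussianDensity d k σ)

/-- Truncated generalized Gaussian `N^g_trunc(k, T, σ)`. -/
def truncGenGaussian (d k : ℕ) (T σ : ℝ) : Measure (Input d) :=
  distOfDensity (Set.indicator {ε | ‖ε‖ ≤ T} (genGaussianDensity d k σ))

/-- The inverse of the cumulative distribution function of the gamma distribution with
shape `a` and rate `1`, in the form `inf {t | p ≤ CDF(t)}`. -/
def gammaCDFInv (a p : ℝ) : ℝ :=
  sInf {t : ℝ | p ≤ cdf (gammaMeasure a 1) t}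

/-- Prediction probability `f^P(x)_c = Pr_{ε ∼ P} [F(x + ε) = c]`. -/
def predProb {d C : ℕ} (P : Measure (Input d)) (F : Input d → Fin C) (x : Input d)
    (c : Fin C) : ℝ :=
  P.real {ε | F (x + ε) = c}

/-- The `argmax` over the classes of the prediction probability, as a set of classes: the
smoothed classifier predicts `y` at `x` when this set is `{y}`. -/
def smoothedArgmax {d C : ℕ} (P : Measure (Input d)) (F : Input d → Fin C) (x : Input d) :
    Set (Fin C) :=
  {c | ∀ c', predProb P F x c' ≤ predProb P F x c}

/-- `(σ, Pcon)`-concentration of the base classifier `F₀` at `x₀` with true label `y₀`. -/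
def Concentration {d C : ℕ} (σ Pcon : ℝ) (F₀ : Input d → Fin C) (x₀ : Input d)
    (y₀ : Fin C) : Prop :=
  ∃ T : ℝ, (gaussian d σ).real {ε | ‖ε‖ ≤ T} = Pcon ∧
    (gaussian d σ)[|{ε | ‖ε‖ ≤ T}] {ε | F₀ (x₀ + ε) = y₀} = 1

/-- `r` is an `ℓ₂` radius certified from the values `PA`, `QA` alone: every base classifier
with these prediction probabilities under `P` and `Q` gives a `P`-smoothed classifier that
predicts `y₀` on the open ball of radius `r` around `x₀`. -/
def IsDSRSCertified {d C : ℕ} (P Q : Measure (Input d)) (x₀ : Input d) (y₀ : Fin C)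
    (PA QA : ℝ) (r : ℝ≥0∞) : Prop :=
  ∀ F : Input d → Fin C, Measurable F → predProb P F x₀ y₀ = PA → predProb Q F x₀ y₀ = QA →
    ∀ x : Input d, edist x x₀ < r → smoothedArgmax P F x = {y₀}

/-- `r_DSRS`: the largest certified radius, with value in `[0, ∞]`. -/
def rDSRS {d C : ℕ} (P Q : Measure (Input d)) (x₀ : Input d) (y₀ : Fin C)
    (PA QA : ℝ) : ℝ≥0∞ :=
  sSup {r | IsDSRSCertified P Q x₀ y₀ PA QA r}

/-- The supremum that defines `r_DSRS` is a maximum. -/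
theorem rDSRS_isGreatest {d C : ℕ} (P Q : Measure (Input d)) (x₀ : Input d) (y₀ : Fin C)
    (PA QA : ℝ) :
    IsGreatest {r | IsDSRSCertified P Q x₀ y₀ PA QA r} (rDSRS P Q x₀ y₀ PA QA) := by
  refine ⟨?_, fun r hr => le_sSup hr⟩
  intro F hF hP hQ x hx
  obtain ⟨r, hr, hxr⟩ := lt_sSup_iff.mp hx
  exact hr F hF hP hQ x hxr

end

end DSRS

namespace DSRS

open Set Real Filter Topology

/-! ### The gamma distribution -/

/-! Write `V = d σ²`. Concentration forces `Q_A = 1`, so every competing `F` equals `y₀` almost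
everywhere on the ball of radius `T` around `x₀`. At `x = x₀ + δ` it therefore suffices that `‖δ +
ε‖ ≤ T` has `P`-probability above `1/2`.

The proof compares two gamma distributions. The radius `T` comes from a fixed quantile of the gamma
law of shape `d/2`, which concentrates around its mean: `T² ≥ 0.9999 V` for large `d`
(`eventually_le_gammaCDFInv`). Under `P`, in contrast, `‖ε‖²` has mean `V` but is a scaled gamma
variable of shape `(d - 2k)/2 ≤ 15` (`genGaussian_real_closedBall`). Its shape stays bounded, so its
skewness survives: its median lies below `0.9994 V` (`half_lt_cdf_gammaMeasure`), with a gap above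
`1/2` that is uniform over the 30 possible shapes (`eventually_median_gap`).

In `‖δ + ε‖² = ‖ε‖² + 2⟪ε, δ⟫ + ‖δ‖²` the last term is at most `0.0004 V`. By rotation invariance
and Chebyshev the cross term exceeds `0.0001 V` on the relevant ball with probability `O(1/d)`
(`measureReal_inner_gt_le`), which for large `d` is less than the gap. -/

theorem integrableOn_gamma {a : ℝ} (ha : 0 < a) :
    IntegrableOn (fun t : ℝ => t ^ (a - 1) * exp (-t)) (Ioi 0) := by
  simpa only [mul_comm] using Real.GammaIntegral_convergent ha

theorem one_sub_cdf_gammaMeasure {a x : ℝ} (ha : 0 < a) (hx : 0 ≤ x) :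
    1 - cdf (gammaMeasure a 1) x = (∫ t in Ioi x, t ^ (a - 1) * exp (-t)) / Gamma a := by
  have := isProbabilityMeasure_gammaMeasure ha one_pos
  rw [cdf_eq_real, ← probReal_compl_eq_one_sub measurableSet_Iic, compl_Iic, measureReal_def,
    gammaMeasure, withDensity_apply _ measurableSet_Ioi]
  simp only [gammaPDF]
  rw [← integral_eq_lintegral_of_nonneg_ae
    (ae_of_all _ fun b => gammaPDFReal_nonneg ha one_pos b) (by fun_prop), ← integral_div]
  refine setIntegral_congr_fun measurableSet_Ioi fun t ht => ?_
  have : 0 ≤ t := hx.trans (le_of_lt ht)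
  simp only [gammaPDFReal, if_pos this, one_rpow, one_mul]
  ring

/-- The substitution `x = a * exp y` puts the mean `a` at `y = 0`, where the new integrand has its
maximum, so that skewness becomes a comparison of `y` with `-y`. -/
theorem integral_gamma_tail_eq_exp {a : ℝ} (ha : 0 < a) (t : ℝ) :
    ∫ x in Ioi (a * exp t), x ^ (a - 1) * exp (-x) =
      a ^ a * exp (-a) * ∫ y in Ioi t, exp (a * (1 + y - exp y)) := by
  rw [← integral_comp_mul_left_Ioi' _ _ ha, ← integral_comp_exp_Ioi, ← integral_const_mul,
    smul_eq_mul, ← integral_const_mul]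
  refine integral_congr_ae (ae_of_all _ fun y => ?_)
  simp only [smul_eq_mul]
  rw [mul_rpow ha.le (exp_pos y).le, ← exp_mul, rpow_sub_one ha.ne', mul_assoc (a ^ a), ← exp_add]
  field_simp
  rw [← exp_add, ← exp_add]
  congr 2
  ring

theorem integral_gamma_eq_exp {a : ℝ} (ha : 0 < a) :
    Integrable (fun y => exp (a * (1 + y - exp y))) ∧
      Gamma a = a ^ a * exp (-a) * ∫ y, exp (a * (1 + y - exp y)) := by
  have key : ∀ y : ℝ, |a * exp y| • ((a * exp y) ^ (a - 1) * exp (-(a * exp y))) =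
      a ^ a * exp (-a) * exp (a * (1 + y - exp y)) := by
    intro y
    rw [abs_of_pos (by positivity), smul_eq_mul, mul_rpow ha.le (exp_pos y).le, ← exp_mul,
      rpow_sub_one ha.ne', mul_assoc (a ^ a), ← exp_add]
    field_simp
    rw [← exp_add, ← exp_add]
    congr 2
    ring
  have himg : (fun y => a * exp y) '' univ = Ioi 0 := by
    ext x
    simp only [image_univ, mem_range, mem_Ioi]
    constructor
    · rintro ⟨y, rfl⟩
      positivity
    · intro hx
      exact ⟨log (x / a), by rw [exp_log (by positivity)]; field_simp⟩
  have hder : ∀ y ∈ univ, HasDerivWithinAt (fun y => a * exp y) (a * exp y) univ y :=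
    fun y _ => ((hasDerivAt_exp y).const_mul a).hasDerivWithinAt
  have hinj : InjOn (fun y => a * exp y) univ := fun x _ y _ h =>
    exp_injective (mul_left_cancel₀ ha.ne' h)
  have hC : a ^ a * exp (-a) ≠ 0 := by positivity
  constructor
  · have := integrableOn_gamma ha
    rw [← himg, integrableOn_image_iff_integrableOn_abs_deriv_smul MeasurableSet.univ hder hinj,
      integrableOn_univ] at this
    simp only [key] at this
    exact (integrable_const_mul_iff (Ne.isUnit hC) _).1 this
  · have := integral_image_eq_integral_abs_deriv_smul MeasurableSet.univ hder hinj
      (fun t => t ^ (a - 1) * exp (-t))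
    simp only [key, himg, setIntegral_univ, integral_const_mul] at this
    rw [← this, Gamma_eq_integral ha]
    simp only [mul_comm]

theorem exp_neg_le_quadratic {y : ℝ} (hy : 0 ≤ y) : exp (-y) ≤ 1 - y + y ^ 2 / 2 := by
  have h := quadratic_le_exp_of_nonneg hy
  rw [exp_neg]
  refine inv_le_of_inv_le₀ (by nlinarith [sq_nonneg (y - 1)]) (le_trans ?_ h)
  rw [inv_eq_one_div, div_le_iff₀ (by nlinarith [sq_nonneg (y - 1)])]
  nlinarith [sq_nonneg (y ^ 2)]

theorem cubic_le_exp {y : ℝ} (hy : 0 ≤ y) : 1 + y + y ^ 2 / 2 + y ^ 3 / 6 ≤ exp y := by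
  refine le_trans (le_of_eq ?_) (sum_le_exp_of_nonneg hy 4)
  simp [Finset.sum_range_succ, Nat.factorial]

theorem exp_gamma_lower {a y : ℝ} (ha : 0 < a) (hy : 0 ≤ y) :
    exp (-(a * y ^ 2 / 2)) ≤ exp (a * (1 + -y - exp (-y))) := by
  rw [exp_le_exp]
  nlinarith [exp_neg_le_quadratic hy]

theorem exp_gamma_upper {a y : ℝ} (ha : 0 < a) (hy : 0 ≤ y) :
    exp (a * (1 + y - exp y)) ≤ exp (-(a * y ^ 2 / 2)) * exp (-(a * y ^ 3 / 6)) := by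
  rw [← exp_add, exp_le_exp]
  nlinarith [cubic_le_exp hy]

/-- The cubic term of `exp y` makes the right side decay faster by a factor `exp (-(a * y ^ 3 /
6))`. On this window `a * y ^ 2` is between 1 and 4, and `a * y ^ 3 ≥ 1 / √a` is bounded below
because `√15 < 3.9`. -/
theorem exp_gamma_gap {a y : ℝ} (ha : 0 < a) (ha' : a ≤ 15) (hy1 : 1 / √a < y)
    (hy2 : y ≤ 2 / √a) :
    0.0054 ≤ exp (a * (1 + -y - exp (-y))) - exp (a * (1 + y - exp y)) := by
  have hs : 0 < √a := sqrt_pos.2 ha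
  have hs' : √a ≤ 3.9 := by
    rw [sqrt_le_left (by norm_num)]; linarith
  have hy : 0 < y := lt_trans (by positivity) hy1
  rw [div_lt_iff₀ hs] at hy1
  rw [le_div_iff₀ hs] at hy2
  have hsq : a * y ^ 2 = (y * √a) ^ 2 := by rw [mul_pow, sq_sqrt ha.le, mul_comm]
  have h2 : a * y ^ 2 ≤ 4 := by rw [hsq]; nlinarith [mul_pos hy hs]
  have h3 : 0.256 ≤ a * y ^ 3 := by
    have : 1 ≤ a * y ^ 2 := by rw [hsq]; nlinarith
    nlinarith
  have hE : 0.135 ≤ exp (-(a * y ^ 2 / 2)) := by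
    have h1 : exp (-2) ≤ exp (-(a * y ^ 2 / 2)) := exp_le_exp.2 (by linarith)
    refine le_trans ?_ h1
    rw [exp_neg, le_inv_comm₀ (by norm_num) (exp_pos _), show (2 : ℝ) = 1 + 1 by norm_num, exp_add]
    nlinarith [exp_one_lt_d9, exp_pos 1]
  have hE' : exp (-(a * y ^ 3 / 6)) ≤ 0.9584 := by
    have h1 : exp (-(a * y ^ 3 / 6)) ≤ exp (-0.0426) := exp_le_exp.2 (by linarith)
    have h2 := exp_neg_le_quadratic (y := 0.0426) (by norm_num)
    exact h1.trans (h2.trans (by norm_num))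
  have hl := exp_gamma_lower ha hy.le
  have hu := exp_gamma_upper ha hy.le
  nlinarith

/-- In the variable `y` the mass left of `0` exceeds the mass right of it by at least `0.0013`, by
`exp_gamma_gap` on a window of length `1 / √a`. Moving the cut from `0` to `log 0.9994` transfers at
most `0.00061`, and `2 * 0.00061 < 0.0013`. -/
theorem half_lt_cdf_gammaMeasure {a : ℝ} (ha : 0 < a) (ha' : a ≤ 15) :
    1 / 2 < cdf (gammaMeasure a 1) (a * 0.9994) := by
  obtain ⟨hint, hG⟩ := integral_gamma_eq_exp ha
  set φ : ℝ → ℝ := fun y => exp (a * (1 + y - exp y)) with hφ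
  set t := log 0.9994 with ht
  have ht0 : t < 0 := log_neg (by norm_num) (by norm_num)
  have ht1 : -0.00061 ≤ t := by
    rw [ht, le_log_iff_exp_le (by norm_num)]
    have := exp_neg_le_quadratic (y := 0.00061) (by norm_num)
    norm_num at this ⊢
    linarith
  have htail := one_sub_cdf_gammaMeasure ha (x := a * 0.9994) (by positivity)
  have htail' := integral_gamma_tail_eq_exp ha t
  rw [ht, exp_log (by norm_num), ← ht] at htail'
  rw [htail', hG, mul_div_mul_left _ _ (by positivity)] at htail
  have hpos : 0 < ∫ y, φ y := by
    have := Gamma_pos_of_pos ha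
    rw [hG] at this
    exact pos_of_mul_pos_right this (by positivity)
  suffices h : 2 * ∫ y in Ioi t, φ y < ∫ y, φ y by
    have : (∫ y in Ioi t, φ y) / ∫ y, φ y < 1 / 2 := by
      rw [div_lt_iff₀ hpos]; linarith
    linarith
  have hneg : Integrable (fun y => φ (-y)) := hint.comp_neg
  have h1 : ∫ y in Ioi t, φ y = (∫ y in Ioc t 0, φ y) + ∫ y in Ioi 0, φ y := by
    rw [← setIntegral_union (Ioc_disjoint_Ioi le_rfl) measurableSet_Ioi hint.integrableOn
      hint.integrableOn, Ioc_union_Ioi_eq_Ioi ht0.le]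
  have h2 : ∫ y, φ y = (∫ y in Ioi 0, φ (-y)) + ∫ y in Ioi 0, φ y := by
    rw [integral_comp_neg_Ioi, neg_zero, ← setIntegral_union (Iic_disjoint_Ioi le_rfl)
      measurableSet_Ioi hint.integrableOn hint.integrableOn, Iic_union_Ioi, setIntegral_univ]
  have h3 : ∫ y in Ioc t 0, φ y ≤ 0.00061 := by
    have : ∫ y in Ioc t 0, φ y ≤ ∫ y in Ioc t 0, (1 : ℝ) := by
      refine setIntegral_mono hint.integrableOn (by simp) fun y => ?_
      rw [hφ]
      simp only [exp_le_one_iff]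
      nlinarith [add_one_le_exp y]
    refine this.trans ?_
    simp [ht0.le]
    linarith
  have h4 : (0.0013 : ℝ) ≤ ∫ y in Ioi 0, (φ (-y) - φ y) := by
    have hs : 0 < √a := sqrt_pos.2 ha
    have hs' : √a ≤ 3.9 := by
      rw [sqrt_le_left (by norm_num)]; linarith
    calc (0.0013 : ℝ) ≤ ∫ y in Ioc (1 / √a) (2 / √a), (0.0054 : ℝ) := by
          simp only [integral_const, MeasurableSet.univ, measureReal_restrict_apply, univ_inter,
            volume_real_Ioc_of_le (show 1 / √a ≤ 2 / √a by gcongr; norm_num), smul_eq_mul]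
          rw [← sub_div, div_mul_eq_mul_div, le_div_iff₀ hs]
          linarith
      _ ≤ ∫ y in Ioc (1 / √a) (2 / √a), (φ (-y) - φ y) := by
          refine setIntegral_mono_on (by simp) (hneg.sub hint).integrableOn measurableSet_Ioc ?_
          exact fun y hy => exp_gamma_gap ha ha' hy.1 hy.2
      _ ≤ ∫ y in Ioi 0, (φ (-y) - φ y) := by
          refine setIntegral_mono_set (hneg.sub hint).integrableOn ?_
            (LE.le.eventuallyLE fun y hy => lt_trans (by positivity) hy.1)
          refine (ae_restrict_iff' measurableSet_Ioi).2 (ae_of_all _ fun y hy => ?_)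
          have hy : 0 < y := hy
          refine sub_nonneg.2 ((exp_gamma_upper ha hy.le).trans (le_trans ?_
            (exp_gamma_lower ha hy.le)))
          exact mul_le_of_le_one_right (exp_pos _).le (by rw [exp_le_one_iff]; nlinarith [pow_pos hy 3])
  rw [integral_sub hneg.integrableOn hint.integrableOn] at h4
  linarith

/-! ### Lower tail and quantiles of the gamma distribution -/

/-- Chernoff bound with tilt `η`: for `t ≤ (1 - η) * a`, `exp (-t) ≤ exp (η * (1 - η) * a) * exp
(-((1 + η) * t))`. The optimal tilt `η / (1 - η)` is not needed. -/
theorem cdf_gammaMeasure_lower_tail_le {a η : ℝ} (ha : 0 < a) (hη : 0 < η) (hη1 : η < 1) :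
    cdf (gammaMeasure a 1) ((1 - η) * a) ≤ (exp (η * (1 - η)) / (1 + η)) ^ a := by
  have hc : 0 ≤ (1 - η) * a := by nlinarith
  have h := one_sub_cdf_gammaMeasure ha hc
  have hint := integrableOn_gamma ha
  have hsplit : Gamma a = (∫ t in Ioc 0 ((1 - η) * a), t ^ (a - 1) * exp (-t)) +
      ∫ t in Ioi ((1 - η) * a), t ^ (a - 1) * exp (-t) := by
    rw [← setIntegral_union (Ioc_disjoint_Ioi le_rfl) measurableSet_Ioi
      (hint.mono_set Ioc_subset_Ioi_self) (hint.mono_set (Ioi_subset_Ioi hc)),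
      Ioc_union_Ioi_eq_Ioi hc, Gamma_eq_integral ha]
    simp only [mul_comm]
  have hG := Gamma_pos_of_pos ha
  have hcdf : cdf (gammaMeasure a 1) ((1 - η) * a) =
      (∫ t in Ioc 0 ((1 - η) * a), t ^ (a - 1) * exp (-t)) / Gamma a := by
    field_simp at h ⊢
    linarith
  have hmul := integral_rpow_mul_exp_neg_mul_Ioi ha (show 0 < 1 + η by linarith)
  have hint' : IntegrableOn (fun t : ℝ => t ^ (a - 1) * exp (-((1 + η) * t))) (Ioi 0) := by
    -- A non-integrable function would have integral `0`, but the closed form is positive.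
    by_contra hcon
    rw [integral_undef hcon] at hmul
    exact absurd hmul.symm (by positivity)
  rw [hcdf, div_le_iff₀ hG, div_rpow (exp_pos _).le (by linarith), ← exp_mul]
  calc ∫ t in Ioc 0 ((1 - η) * a), t ^ (a - 1) * exp (-t)
      ≤ ∫ t in Ioc 0 ((1 - η) * a), exp (η * (1 - η) * a) *
          (t ^ (a - 1) * exp (-((1 + η) * t))) := by
        refine setIntegral_mono_on (hint.mono_set Ioc_subset_Ioi_self)
          ((hint'.mono_set Ioc_subset_Ioi_self).const_mul _) measurableSet_Ioc fun t ht => ?_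
        rw [mul_left_comm, ← exp_add]
        refine mul_le_mul_of_nonneg_left (exp_le_exp.2 ?_) (rpow_nonneg ht.1.le _)
        nlinarith [ht.2]
    _ = exp (η * (1 - η) * a) *
          ∫ t in Ioc 0 ((1 - η) * a), t ^ (a - 1) * exp (-((1 + η) * t)) := by
        rw [integral_const_mul]
    _ ≤ exp (η * (1 - η) * a) * ∫ t in Ioi 0, t ^ (a - 1) * exp (-((1 + η) * t)) := by
        refine mul_le_mul_of_nonneg_left (setIntegral_mono_set hint' ?_
          (LE.le.eventuallyLE Ioc_subset_Ioi_self)) (exp_pos _).le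
        refine (ae_restrict_iff' measurableSet_Ioi).2 (ae_of_all _ fun t ht => ?_)
        exact mul_nonneg (rpow_nonneg (le_of_lt ht) _) (exp_pos _).le
    _ = _ := by
        rw [hmul, one_div, inv_rpow (by linarith)]
        field_simp

theorem tendsto_cdf_gammaMeasure_lower_tail {η : ℝ} (hη : 0 < η) (hη1 : η < 1) :
    Tendsto (fun a => cdf (gammaMeasure a 1) ((1 - η) * a)) atTop (𝓝 0) := by
  have hq : exp (η * (1 - η)) / (1 + η) < 1 := by
    rw [div_lt_one (by linarith)]
    have h1 := add_one_le_exp (-(η * (1 - η)))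
    have h2 : 0 < 1 - η * (1 - η) := by nlinarith
    have h3 : exp (η * (1 - η)) ≤ (1 - η * (1 - η))⁻¹ := by
      rw [le_inv_comm₀ (exp_pos _) h2, ← exp_neg]
      linarith
    refine h3.trans_lt ?_
    rw [inv_eq_one_div, div_lt_iff₀ h2]
    -- `(1 + η) * (1 - η + η ^ 2) = 1 + η ^ 3 > 1`.
    nlinarith [pow_pos hη 3]
  refine squeeze_zero' (Eventually.of_forall fun a => cdf_nonneg _ _) ?_
    (tendsto_rpow_atTop_of_base_lt_one _ (lt_trans (by norm_num) (show 0 < _ by positivity)) hq)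
  filter_upwards [eventually_gt_atTop 0] with a ha
  exact cdf_gammaMeasure_lower_tail_le ha hη hη1

/-- The `p`-quantile of the gamma distribution of shape `a` is at least `(1 - η) a` for large `a`. -/
theorem eventually_le_gammaCDFInv {p η : ℝ} (hp : 0 < p) (hp1 : p < 1) (hη : 0 < η)
    (hη1 : η < 1) : ∀ᶠ a in atTop, (1 - η) * a ≤ gammaCDFInv a p := by
  filter_upwards [(tendsto_cdf_gammaMeasure_lower_tail hη hη1).eventually_lt_const hp] with a ha
  refine le_csInf ?_ fun t ht => ?_
  · obtain ⟨t, ht⟩ := ((tendsto_cdf_atTop (gammaMeasure a 1)).eventually_const_lt hp1).exists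
    exact ⟨t, ht.le⟩
  · by_contra! hlt
    exact absurd (lt_of_le_of_lt (le_trans ht (monotone_cdf _ hlt.le)) ha) (lt_irrefl p)

/-- A quantile of a gamma distribution is a lower bound for the points where the distribution
function reaches the level. -/
theorem gammaCDFInv_le {a p t : ℝ} (hp : 0 < p) (h : p ≤ cdf (gammaMeasure a 1) t) :
    gammaCDFInv a p ≤ t := by
  refine csInf_le ?_ h
  obtain ⟨s, hs⟩ := ((tendsto_cdf_atBot (gammaMeasure a 1)).eventually_lt_const hp).exists
  refine ⟨s, fun u hu => ?_⟩
  by_contra! hlt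
  exact absurd (lt_of_le_of_lt (le_trans hu (monotone_cdf _ hlt.le)) hs) (lt_irrefl p)

/-! ### Radial distributions -/

theorem integral_pow_mul_exp_neg_mul_sq_Ioi {m : ℕ} {b s : ℝ} (hm : 0 < m) (hb : 0 < b)
    (hs : 0 ≤ s) :
    ∫ y in Ioi s, y ^ (m - 1) * exp (-(b * y ^ 2)) =
      b ^ (-((m : ℝ) / 2)) / 2 *
        ∫ t in Ioi (b * s ^ 2), t ^ ((m : ℝ) / 2 - 1) * exp (-t) := by
  have h := integral_comp_rpow_Ioi_of_pos' (g := fun t => (b * t) ^ ((m : ℝ) / 2 - 1) *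
    exp (-(b * t))) (p := 2) two_pos (sq_nonneg s)
  rw [← integral_comp_mul_left_Ioi' _ _ hb, ← h]
  have : (s ^ 2) ^ ((2 : ℝ)⁻¹) = s := by
    rw [← one_div, ← sqrt_eq_rpow, sqrt_sq hs]
  rw [this, smul_eq_mul, ← integral_const_mul, ← integral_const_mul]
  refine setIntegral_congr_fun measurableSet_Ioi fun y hy => ?_
  have hy : 0 < y := lt_of_le_of_lt hs hy
  simp only [smul_eq_mul]
  have e1 : y ^ (2 - 1 : ℝ) = y := by norm_num
  have e2 : y ^ (2 : ℝ) = y ^ 2 := rpow_two y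
  have e3 : (y ^ 2) ^ ((m : ℝ) / 2 - 1) * y = y ^ (m - 1) := by
    rw [← rpow_natCast y 2, ← rpow_mul hy.le, ← rpow_natCast y (m - 1), Nat.cast_sub hm]
    nth_rw 2 [← rpow_one y]
    rw [← rpow_add hy]
    congr 1
    push_cast
    ring
  have e4 : b ^ (-((m : ℝ) / 2)) * b * b ^ ((m : ℝ) / 2 - 1) = 1 := by
    nth_rw 2 [← rpow_one b]
    rw [← rpow_add hb, ← rpow_add hb]
    norm_num
  rw [e1, e2, mul_rpow hb.le (by positivity)]
  linear_combination (-(y ^ (m - 1) * exp (-(b * y ^ 2)))) * e4 -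
    (b ^ (-((m : ℝ) / 2)) * b * b ^ ((m : ℝ) / 2 - 1) * exp (-(b * y ^ 2))) * e3

theorem distOfDensity_real_apply {d : ℕ} {g : Input d → ℝ} (hg0 : 0 ≤ g) (hg : Integrable g)
    {S : Set (Input d)} (hS : MeasurableSet S) :
    (distOfDensity g).real S = (∫ ε in S, g ε) / ∫ ε, g ε := by
  rw [distOfDensity, measureReal_ennreal_smul_apply, measureReal_def, withDensity_apply _ hS,
    ENNReal.toReal_inv,
    ← integral_eq_lintegral_of_nonneg_ae (ae_of_all _ hg0) hg.aestronglyMeasurable,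
    ← integral_eq_lintegral_of_nonneg_ae (ae_of_all _ hg0) hg.aestronglyMeasurable.restrict]
  ring

theorem isProbabilityMeasure_distOfDensity {d : ℕ} {g : Input d → ℝ} (hg0 : 0 ≤ g)
    (hg : Integrable g) (hpos : 0 < ∫ ε, g ε) : IsProbabilityMeasure (distOfDensity g) := by
  constructor
  rw [distOfDensity, Measure.smul_apply, withDensity_apply _ MeasurableSet.univ,
    Measure.restrict_univ, smul_eq_mul, ← ofReal_integral_eq_lintegral_ofReal hg (ae_of_all _ hg0)]
  exact ENNReal.inv_mul_cancel (by simpa using hpos) ENNReal.ofReal_ne_top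

theorem distOfDensity_absolutelyContinuous {d : ℕ} (g : Input d → ℝ) :
    distOfDensity g ≪ volume :=
  Measure.smul_absolutelyContinuous.trans (withDensity_absolutelyContinuous _ _)

theorem measurePreserving_distOfDensity_norm {d : ℕ} (h : ℝ → ℝ)
    (L : Input d ≃ₗᵢ[ℝ] Input d) :
    MeasurePreserving L (distOfDensity fun ε : Input d => h ‖ε‖)
      (distOfDensity fun ε => h ‖ε‖) := by
  refine ⟨L.continuous.measurable, ?_⟩
  ext s hs
  rw [Measure.map_apply L.continuous.measurable hs, distOfDensity, Measure.smul_apply,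
    Measure.smul_apply, withDensity_apply _ hs,
    withDensity_apply _ (L.continuous.measurable hs),
    ← L.measurePreserving.setLIntegral_comp_preimage_emb
      L.toHomeomorph.measurableEmbedding (fun ε => ENNReal.ofReal (h ‖ε‖)) s]
  simp only [LinearIsometryEquiv.norm_map]

theorem sigma'_sq {d k : ℕ} (σ : ℝ) (hk : 2 * k < d) :
    sigma' d k σ ^ 2 = d * σ ^ 2 / (d - 2 * k : ℕ) := by
  have : (0 : ℝ) < (d : ℝ) - 2 * k := by
    have : ((2 * k : ℕ) : ℝ) < d := by exact_mod_cast hk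
    push_cast at this; linarith
  rw [sigma', mul_pow, sq_sqrt (by positivity), Nat.cast_sub hk.le]
  push_cast
  ring

/-- The polar Jacobian absorbs the singular factor, leaving the radial density of a Gaussian in
dimension `d - 2k`. The choice of `σ'` keeps the mean squared radius at `d σ²`. -/
theorem pow_mul_genGaussian_radial {d k : ℕ} {σ : ℝ} (hk : 2 * k < d) {y : ℝ}
    (hy : 0 < y) :
    y ^ (d - 1) * ((y ^ (2 * k))⁻¹ * exp (-y ^ 2 / (2 * sigma' d k σ ^ 2))) =
      y ^ (d - 2 * k - 1) * exp (-((d - 2 * k : ℕ) / (2 * (d * σ ^ 2)) * y ^ 2)) := by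
  rw [sigma'_sq σ hk, ← mul_assoc]
  congr 1
  · rw [← div_eq_mul_inv, div_eq_iff (by positivity), ← pow_add]
    congr 1
    omega
  · congr 1
    rw [mul_div_assoc', div_div_eq_mul_div]
    ring

theorem integrable_genGaussianDensity {d k : ℕ} {σ : ℝ} (hk : 2 * k < d) (hσ : 0 < σ) :
    Integrable (genGaussianDensity d k σ) := by
  have : Nonempty (Fin d) := ⟨⟨0, by omega⟩⟩
  have hd : (0 : ℝ) < d := by exact_mod_cast (by omega : 0 < d)
  have hm : (0 : ℝ) < (d - 2 * k : ℕ) := by exact_mod_cast (by omega : 0 < d - 2 * k)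
  refine (integrable_fun_norm_addHaar volume
    (f := fun y => (y ^ (2 * k))⁻¹ * exp (-y ^ 2 / (2 * sigma' d k σ ^ 2)))).2 ?_
  refine (integrableOn_rpow_mul_exp_neg_mul_sq
    (b := (d - 2 * k : ℕ) / (2 * (d * σ ^ 2))) (by positivity)
    (s := (d - 2 * k - 1 : ℕ)) ?_).congr_fun ?_ measurableSet_Ioi
  · exact lt_of_lt_of_le (by norm_num) (Nat.cast_nonneg _)
  · intro y hy
    simp only [smul_eq_mul, finrank_euclideanSpace_fin]
    rw [pow_mul_genGaussian_radial hk hy, rpow_natCast, neg_mul]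

theorem setIntegral_genGaussianDensity_tail {d k : ℕ} {σ s : ℝ} (hk : 2 * k < d)
    (hs : 0 ≤ s) :
    ∫ ε in {ε : Input d | s < ‖ε‖}, genGaussianDensity d k σ ε =
      d • (volume : Measure (Input d)).real (Metric.ball 0 1) •
      ∫ y in Ioi s, y ^ (d - 2 * k - 1) * exp (-((d - 2 * k : ℕ) / (2 * (d * σ ^ 2)) * y ^ 2)) := by
  have : Nonempty (Fin d) := ⟨⟨0, by omega⟩⟩
  have hS : MeasurableSet {ε : Input d | s < ‖ε‖} := measurableSet_lt measurable_const measurable_norm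
  rw [← integral_indicator hS]
  have h := integral_fun_norm_addHaar (volume : Measure (Input d)) (indicator (Ioi s)
    fun y => (y ^ (2 * k))⁻¹ * exp (-y ^ 2 / (2 * sigma' d k σ ^ 2)))
  rw [finrank_euclideanSpace_fin] at h
  refine Eq.trans (integral_congr_ae (ae_of_all _ fun ε => ?_)) (h.trans ?_)
  · rfl
  · congr 2
    have : ∀ y, y ^ (d - 1) • indicator (Ioi s)
        (fun y => (y ^ (2 * k))⁻¹ * exp (-y ^ 2 / (2 * sigma' d k σ ^ 2))) y =
        indicator (Ioi s) (fun y => y ^ (d - 1) *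
          ((y ^ (2 * k))⁻¹ * exp (-y ^ 2 / (2 * sigma' d k σ ^ 2)))) y := fun y => by
      by_cases hy : y ∈ Ioi s <;> simp [hy]
    simp only [this]
    rw [setIntegral_indicator measurableSet_Ioi, inter_eq_right.2 (Ioi_subset_Ioi hs)]
    exact setIntegral_congr_fun measurableSet_Ioi fun y hy =>
      pow_mul_genGaussian_radial hk (lt_of_le_of_lt hs hy)

/-- The constant does not depend on `s`, so it cancels when a tail is divided by the total mass, the
case `s = 0`. -/
theorem setIntegral_genGaussianDensity_tail_eq_gamma {d k : ℕ} {σ : ℝ} (hk : 2 * k < d)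
    (hσ : 0 < σ) : ∃ c : ℝ, 0 < c ∧ ∀ s, 0 ≤ s →
    ∫ ε in {ε : Input d | s < ‖ε‖}, genGaussianDensity d k σ ε =
      c * ∫ t in Ioi ((d - 2 * k : ℕ) / (2 * (d * σ ^ 2)) * s ^ 2),
        t ^ (((d - 2 * k : ℕ) : ℝ) / 2 - 1) * exp (-t) := by
  have : Nonempty (Fin d) := ⟨⟨0, by omega⟩⟩
  have hd : (0 : ℝ) < d := by exact_mod_cast (by omega : 0 < d)
  have hm : (0 : ℝ) < (d - 2 * k : ℕ) := by exact_mod_cast (by omega : 0 < d - 2 * k)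
  have hb : (0 : ℝ) < (d - 2 * k : ℕ) / (2 * (d * σ ^ 2)) := by positivity
  have hv : 0 < (volume : Measure (Input d)).real (Metric.ball 0 1) :=
    ENNReal.toReal_pos (Metric.measure_ball_pos _ _ one_pos).ne' measure_ball_lt_top.ne
  refine ⟨d * (volume : Measure (Input d)).real (Metric.ball 0 1) *
    (((d - 2 * k : ℕ) / (2 * (d * σ ^ 2))) ^ (-(((d - 2 * k : ℕ) : ℝ) / 2)) / 2), by positivity,
    fun s hs => ?_⟩
  rw [setIntegral_genGaussianDensity_tail hk hs,
    integral_pow_mul_exp_neg_mul_sq_Ioi (by omega) hb hs]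
  simp only [nsmul_eq_mul, smul_eq_mul]
  ring

theorem genGaussianDensity_nonneg (d k : ℕ) (σ : ℝ) : 0 ≤ genGaussianDensity d k σ := fun ε => by
  unfold genGaussianDensity
  positivity

theorem genGaussianDensity_pos {d : ℕ} (k : ℕ) (σ : ℝ) {ε : Input d} (hε : ε ≠ 0) :
    0 < genGaussianDensity d k σ ε := by
  have := norm_pos_iff.2 hε
  unfold genGaussianDensity
  positivity

theorem ae_ne_zero {d : ℕ} (hd : 0 < d) : ∀ᵐ ε : Input d, ε ≠ 0 := by
  have : Nonempty (Fin d) := ⟨⟨0, hd⟩⟩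
  simp [ae_iff]

theorem setIntegral_genGaussianDensity_pos {d k : ℕ} {σ : ℝ} (hk : 2 * k < d) (hσ : 0 < σ)
    {S : Set (Input d)} (hS : volume S ≠ 0) : 0 < ∫ ε in S, genGaussianDensity d k σ ε := by
  rw [setIntegral_pos_iff_support_of_nonneg_ae (ae_of_all _ (genGaussianDensity_nonneg d k σ))
    (integrable_genGaussianDensity hk hσ).integrableOn, pos_iff_ne_zero]
  refine fun h => hS ?_
  rw [← measure_inter_add_sdiff₀ (μ := volume) S (t := Function.support (genGaussianDensity d k σ))
    ?_, inter_comm, h, zero_add]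
  · refine measure_mono_null (fun ε hε => ?_) (ae_iff.1 (ae_ne_zero (d := d) (by omega)))
    intro h0
    exact hε.2 (genGaussianDensity_pos k σ h0).ne'
  · exact (integrable_genGaussianDensity hk hσ).aestronglyMeasurable.nullMeasurableSet_support

theorem isProbabilityMeasure_genGaussian {d k : ℕ} {σ : ℝ} (hk : 2 * k < d) (hσ : 0 < σ) :
    IsProbabilityMeasure (genGaussian d k σ) := by
  refine isProbabilityMeasure_distOfDensity (genGaussianDensity_nonneg d k σ)
    (integrable_genGaussianDensity hk hσ) ?_
  rw [← setIntegral_univ]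
  exact setIntegral_genGaussianDensity_pos hk hσ (NeZero.ne _)

/-- The squared norm of a generalized Gaussian vector has a scaled gamma distribution. -/
theorem genGaussian_real_closedBall {d k : ℕ} {σ s : ℝ} (hk : 2 * k < d) (hσ : 0 < σ)
    (hs : 0 ≤ s) :
    (genGaussian d k σ).real {ε | ‖ε‖ ≤ s} =
      cdf (gammaMeasure (((d - 2 * k : ℕ) : ℝ) / 2) 1)
        ((d - 2 * k : ℕ) / (2 * (d * σ ^ 2)) * s ^ 2) := by
  have hm : (0 : ℝ) < (d - 2 * k : ℕ) := by exact_mod_cast (by omega : 0 < d - 2 * k)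
  have := isProbabilityMeasure_genGaussian hk hσ
  have hS : MeasurableSet {ε : Input d | s < ‖ε‖} := measurableSet_lt measurable_const measurable_norm
  have hcompl : {ε : Input d | ‖ε‖ ≤ s} = {ε : Input d | s < ‖ε‖}ᶜ := by
    ext; simp
  obtain ⟨c, hc, h⟩ := setIntegral_genGaussianDensity_tail_eq_gamma (d := d) (k := k) (σ := σ) hk hσ
  have h0 := h 0 le_rfl
  have hae : ({ε : Input d | 0 < ‖ε‖} : Set _) =ᵐ[volume] univ := by
    filter_upwards [ae_ne_zero (d := d) (by omega)] with ε hε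
    exact eq_true (norm_pos_iff.2 hε)
  rw [setIntegral_congr_set hae, setIntegral_univ, zero_pow two_ne_zero, mul_zero] at h0
  rw [hcompl, probReal_compl_eq_one_sub hS, genGaussian, distOfDensity_real_apply
    (genGaussianDensity_nonneg d k σ) (integrable_genGaussianDensity hk hσ) hS, h s hs, h0,
    mul_div_mul_left _ _ hc.ne']
  have h1 := one_sub_cdf_gammaMeasure (a := ((d - 2 * k : ℕ) : ℝ) / 2)
    (x := (d - 2 * k : ℕ) / (2 * (d * σ ^ 2)) * s ^ 2) (by positivity) (by positivity)
  have h2 : Gamma (((d - 2 * k : ℕ) : ℝ) / 2) =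
      ∫ t in Ioi 0, t ^ (((d - 2 * k : ℕ) : ℝ) / 2 - 1) * exp (-t) := by
    rw [Gamma_eq_integral (by positivity)]
    simp only [mul_comm]
  rw [← h2, ← h1]
  ring

theorem gaussian_eq_genGaussian {d : ℕ} (hd : 0 < d) (σ : ℝ) :
    gaussian d σ = genGaussian d 0 σ := by
  unfold gaussian genGaussian
  congr 1
  ext ε
  rw [genGaussianDensity, sigma'_sq σ (by omega)]
  have : (d : ℝ) ≠ 0 := by exact_mod_cast hd.ne'
  simp [mul_div_cancel_left₀ _ this]

/-! ### Rotation invariance -/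

/-- By invariance `δ` may be replaced by `‖δ‖` times any basis vector. Summing over the `d` basis
vectors turns the coordinate squares into `‖ε‖ ^ 2 ≤ ρ ^ 2`. -/
theorem setLIntegral_inner_sq_le {d : ℕ} {μ : Measure (Input d)} [IsProbabilityMeasure μ]
    (hμ : ∀ L : Input d ≃ₗᵢ[ℝ] Input d, MeasurePreserving L μ μ) (δ : Input d) (ρ : ℝ) :
    d * ∫⁻ ε in {ε | ‖ε‖ ≤ ρ}, ENNReal.ofReal (inner ℝ ε δ ^ 2) ∂μ ≤
      ENNReal.ofReal (‖δ‖ ^ 2 * ρ ^ 2) := by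
  have hB : MeasurableSet {ε : Input d | ‖ε‖ ≤ ρ} :=
    measurableSet_le measurable_norm measurable_const
  have hcoord : ∀ i : Fin d,
      ∫⁻ ε in {ε | ‖ε‖ ≤ ρ}, ENNReal.ofReal (inner ℝ ε δ ^ 2) ∂μ =
        ∫⁻ ε in {ε | ‖ε‖ ≤ ρ}, ENNReal.ofReal (‖δ‖ ^ 2 * ε i ^ 2) ∂μ := by
    intro i
    set w : Input d := ‖δ‖ • EuclideanSpace.single i (1 : ℝ) with hw
    have hnorm : ‖w‖ = ‖δ‖ := by simp [hw, norm_smul]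
    -- Vectors of equal norm are exchanged by the reflection in their bisecting hyperplane.
    set L := Submodule.reflection (Submodule.span ℝ {w - δ})ᗮ with hL
    have hLw : L w = δ := Submodule.reflection_sub hnorm
    have hpre : L ⁻¹' {ε : Input d | ‖ε‖ ≤ ρ} = {ε | ‖ε‖ ≤ ρ} := by
      ext; simp
    rw [← (hμ L).setLIntegral_comp_preimage_emb L.toHomeomorph.measurableEmbedding
      (fun ε => ENNReal.ofReal (inner ℝ ε δ ^ 2)), hpre]
    refine lintegral_congr fun ε => ?_
    have hinner : inner ℝ (L ε) δ = inner ℝ ε w := by rw [← L.inner_map_map ε w, hLw]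
    rw [hinner, hw, inner_smul_right, EuclideanSpace.inner_single_right]
    simp [mul_pow]
  calc d * ∫⁻ ε in {ε | ‖ε‖ ≤ ρ}, ENNReal.ofReal (inner ℝ ε δ ^ 2) ∂μ
      = ∑ i : Fin d, ∫⁻ ε in {ε | ‖ε‖ ≤ ρ}, ENNReal.ofReal (‖δ‖ ^ 2 * ε i ^ 2) ∂μ := by
        rw [← Finset.sum_congr rfl fun i _ => hcoord i]
        simp
    _ = ∫⁻ ε in {ε | ‖ε‖ ≤ ρ}, ∑ i : Fin d, ENNReal.ofReal (‖δ‖ ^ 2 * ε i ^ 2) ∂μ := by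
        rw [lintegral_finsetSum]
        intro i _
        fun_prop
    _ ≤ ∫⁻ ε in {ε | ‖ε‖ ≤ ρ}, ENNReal.ofReal (‖δ‖ ^ 2 * ρ ^ 2) ∂μ := by
        refine setLIntegral_mono' hB fun ε hε => ?_
        have hε : ‖ε‖ ≤ ρ := hε
        rw [← ENNReal.ofReal_sum_of_nonneg fun i _ => by positivity, ← Finset.mul_sum,
          ← EuclideanSpace.real_norm_sq_eq]
        gcongr
    _ ≤ ENNReal.ofReal (‖δ‖ ^ 2 * ρ ^ 2) := by
        rw [setLIntegral_const]
        exact mul_le_of_le_one_right' prob_le_one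

theorem measureReal_inner_gt_le {d : ℕ} (hd : 0 < d) {μ : Measure (Input d)}
    [IsProbabilityMeasure μ] (hμ : ∀ L : Input d ≃ₗᵢ[ℝ] Input d, MeasurePreserving L μ μ)
    (δ : Input d) (ρ : ℝ) {τ : ℝ} (hτ : 0 < τ) :
    μ.real {ε | ‖ε‖ ≤ ρ ∧ τ < inner ℝ ε δ} ≤ ‖δ‖ ^ 2 * ρ ^ 2 / (d * τ ^ 2) := by
  have hd' : (0 : ℝ) < d := by exact_mod_cast hd
  have hB : MeasurableSet {ε : Input d | ‖ε‖ ≤ ρ} :=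
    measurableSet_le measurable_norm measurable_const
  have h1 := setLIntegral_inner_sq_le hμ δ ρ
  have h2 := mul_meas_ge_le_lintegral₀ (μ := μ.restrict {ε | ‖ε‖ ≤ ρ})
    (f := fun ε : Input d => ENNReal.ofReal (inner ℝ ε δ ^ 2)) (by fun_prop)
    (ENNReal.ofReal (τ ^ 2))
  have h3 : μ {ε | ‖ε‖ ≤ ρ ∧ τ < inner ℝ ε δ} ≤ μ.restrict {ε | ‖ε‖ ≤ ρ}
      {ε : Input d | ENNReal.ofReal (τ ^ 2) ≤ ENNReal.ofReal (inner ℝ ε δ ^ 2)} := by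
    rw [Measure.restrict_apply (measurableSet_le measurable_const (by fun_prop))]
    refine measure_mono fun ε hε => ⟨?_, hε.1⟩
    exact ENNReal.ofReal_le_ofReal (by have := hε.2; gcongr)
  have h4 : ENNReal.ofReal (d * τ ^ 2) * μ {ε | ‖ε‖ ≤ ρ ∧ τ < inner ℝ ε δ} ≤
      ENNReal.ofReal (‖δ‖ ^ 2 * ρ ^ 2) := by
    refine le_trans ?_ h1
    rw [ENNReal.ofReal_mul hd'.le, ENNReal.ofReal_natCast, mul_assoc]
    gcongr
    exact le_trans (by gcongr) h2
  rw [le_div_iff₀ (by positivity), mul_comm]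
  have h5 := ENNReal.toReal_mono ENNReal.ofReal_ne_top h4
  rwa [ENNReal.toReal_mul, ENNReal.toReal_ofReal (by positivity),
    ENNReal.toReal_ofReal (by positivity)] at h5

theorem measurePreserving_genGaussian {d : ℕ} (k : ℕ) (σ : ℝ) (L : Input d ≃ₗᵢ[ℝ] Input d) :
    MeasurePreserving L (genGaussian d k σ) (genGaussian d k σ) :=
  measurePreserving_distOfDensity_norm
    (fun y => (y ^ (2 * k))⁻¹ * exp (-y ^ 2 / (2 * sigma' d k σ ^ 2))) L

/-- A shifted ball of squared radius slightly below `d σ²` has mass above `1 / 2` under the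
generalized Gaussian, if the dimension is large compared with `(d - 2k) / 2`. -/
theorem half_lt_genGaussian_shifted_ball {d k : ℕ} {σ T : ℝ} (hk : 2 * k < d) (hσ : 0 < σ)
    (hd : 160000 / d <
      cdf (gammaMeasure (((d - 2 * k : ℕ) : ℝ) / 2) 1) (((d - 2 * k : ℕ) : ℝ) / 2 * 0.9994) - 1 / 2)
    (hT0 : 0 ≤ T) (hT : 0.9999 * (d * σ ^ 2) ≤ T ^ 2) {δ : Input d}
    (hδ : ‖δ‖ ≤ 0.02 * σ * √d) :
    1 / 2 < (genGaussian d k σ).real {ε | ‖δ + ε‖ ≤ T} := by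
  have hd0 : (0 : ℝ) < d := by exact_mod_cast (by omega : 0 < d)
  have := isProbabilityMeasure_genGaussian hk hσ
  set V : ℝ := d * σ ^ 2 with hV
  have hV0 : 0 < V := by positivity
  have hδ2 : ‖δ‖ ^ 2 ≤ 0.0004 * V := by
    calc ‖δ‖ ^ 2 ≤ (0.02 * σ * √d) ^ 2 := by gcongr
      _ = 0.0004 * V := by rw [mul_pow, sq_sqrt hd0.le, hV]; ring
  have hball := genGaussian_real_closedBall hk hσ (sqrt_nonneg (0.9994 * V))
  rw [sq_sqrt (by positivity), show ((d - 2 * k : ℕ) : ℝ) / (2 * V) * (0.9994 * V) =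
    ((d - 2 * k : ℕ) : ℝ) / 2 * 0.9994 by field_simp] at hball
  have hbad := measureReal_inner_gt_le (by omega) (measurePreserving_genGaussian k σ) δ
    (√V) (τ := 0.00005 * V) (by positivity)
  -- `0.0004 / 0.00005 ^ 2 = 160000`.
  have hbad' : ‖δ‖ ^ 2 * √V ^ 2 / (d * (0.00005 * V) ^ 2) ≤ 160000 / d := by
    rw [sq_sqrt hV0.le, div_le_div_iff₀ (by positivity) hd0]
    nlinarith [mul_le_mul_of_nonneg_right hδ2 (mul_pos hV0 hd0).le]
  -- The budget closes exactly: `0.9994 + 2 * 0.00005 + 0.0004 = 0.9999`.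
  have hsub : {ε : Input d | ‖ε‖ ≤ √(0.9994 * V)} ⊆
      {ε | ‖δ + ε‖ ≤ T} ∪ {ε | ‖ε‖ ≤ √V ∧ 0.00005 * V < inner ℝ ε δ} := by
    intro ε hε
    have hε : ‖ε‖ ≤ √(0.9994 * V) := hε
    by_cases h : 0.00005 * V < inner ℝ ε δ
    · exact Or.inr ⟨hε.trans (sqrt_le_sqrt (by linarith)), h⟩
    · left
      have hε2 : ‖ε‖ ^ 2 ≤ 0.9994 * V := by
        rw [← sq_sqrt (show 0 ≤ 0.9994 * V by positivity)]
        gcongr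
      refine abs_le_of_sq_le_sq' ?_ hT0 |>.2
      rw [add_comm, norm_add_sq_real]
      linarith
  have hle := (measureReal_mono (μ := genGaussian d k σ) hsub).trans (measureReal_union_le _ _)
  linarith

/-! ### Null sets: from probability one to almost everywhere on a ball -/

theorem lintegral_ofReal_ne_top {d : ℕ} {g : Input d → ℝ} (hg : Integrable g) :
    ∫⁻ ε, ENNReal.ofReal (g ε) ≠ ∞ :=
  ((lintegral_ofReal_le_lintegral_enorm g).trans_lt hg.hasFiniteIntegral).ne

/-- Lebesgue measure is absolutely continuous with respect to a distribution on a set where its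
density is positive. -/
theorem restrict_absolutelyContinuous_distOfDensity_indicator {d : ℕ} {g : Input d → ℝ}
    {B : Set (Input d)} (hB : MeasurableSet B) (hg : Integrable g) (hpos : ∀ᵐ ε, 0 < g ε) :
    (volume : Measure (Input d)).restrict B ≪ distOfDensity (indicator B g) := by
  rw [distOfDensity]
  refine Measure.AbsolutelyContinuous.smul_right ?_
    (ENNReal.inv_ne_zero.2 (lintegral_ofReal_ne_top (hg.indicator hB)))
  have : (fun ε => ENNReal.ofReal (indicator B g ε)) =
      indicator B fun ε => ENNReal.ofReal (g ε) := by
    ext ε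
    by_cases h : ε ∈ B <;> simp [h]
  rw [this, withDensity_indicator hB]
  refine withDensity_absolutelyContinuous' hg.aestronglyMeasurable.aemeasurable.ennreal_ofReal.restrict ?_
  filter_upwards [ae_restrict_of_ae hpos] with ε hε
  simpa using hε

theorem distOfDensity_indicator_absolutelyContinuous {d : ℕ} (g : Input d → ℝ)
    {B : Set (Input d)} (hB : MeasurableSet B) :
    distOfDensity (indicator B g) ≪ (volume : Measure (Input d)).restrict B := by
  have : (fun ε => ENNReal.ofReal (indicator B g ε)) =
      indicator B fun ε => ENNReal.ofReal (g ε) := by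
    ext ε
    by_cases h : ε ∈ B <;> simp [h]
  rw [distOfDensity, this, withDensity_indicator hB]
  exact Measure.smul_absolutelyContinuous.trans (withDensity_absolutelyContinuous _ _)

theorem ae_genGaussianDensity_pos {d : ℕ} (k : ℕ) (σ : ℝ) (hd : 0 < d) :
    ∀ᵐ ε : Input d, 0 < genGaussianDensity d k σ ε := by
  filter_upwards [ae_ne_zero hd] with ε hε using genGaussianDensity_pos k σ hε

theorem measurableSet_norm_le {d : ℕ} (T : ℝ) : MeasurableSet {ε : Input d | ‖ε‖ ≤ T} :=
  measurableSet_le measurable_norm measurable_const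

theorem isProbabilityMeasure_truncGenGaussian {d k : ℕ} {σ T : ℝ} (hk : 2 * k < d)
    (hσ : 0 < σ) (hT : 0 < T) : IsProbabilityMeasure (truncGenGaussian d k T σ) := by
  refine isProbabilityMeasure_distOfDensity
    (indicator_nonneg fun ε _ => genGaussianDensity_nonneg d k σ ε)
    ((integrable_genGaussianDensity hk hσ).indicator (measurableSet_norm_le T)) ?_
  rw [integral_indicator (measurableSet_norm_le T)]
  refine setIntegral_genGaussianDensity_pos hk hσ ?_
  have : {ε : Input d | ‖ε‖ ≤ T} = Metric.closedBall 0 T := by ext; simp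
  rw [this]
  exact (Metric.measure_closedBall_pos _ _ hT).ne'

/-- The truncated distribution and Lebesgue measure on the ball have the same null sets. This is
used in both directions: to compute `Q_A = 1` for the base classifier, and to extract geometric
information about a competitor from that value. -/
theorem truncGenGaussian_real_eq_one_iff {d k : ℕ} {σ T : ℝ} (hk : 2 * k < d)
    (hσ : 0 < σ) (hT : 0 < T) {S : Set (Input d)} (hS : MeasurableSet S) :
    (truncGenGaussian d k T σ).real S = 1 ↔ ∀ᵐ ε : Input d, ‖ε‖ ≤ T → ε ∈ S := by
  have := isProbabilityMeasure_truncGenGaussian hk hσ hT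
  have hB := measurableSet_norm_le (d := d) T
  rw [measureReal_def, ENNReal.toReal_eq_one_iff, ← mem_ae_iff_prob_eq_one hS]
  change (∀ᵐ ε ∂(truncGenGaussian d k T σ), ε ∈ S) ↔ _
  refine Iff.trans ?_ (ae_restrict_iff' (s := {ε | ‖ε‖ ≤ T}) (p := fun ε => ε ∈ S) hB)
  exact ⟨fun h => (restrict_absolutelyContinuous_distOfDensity_indicator hB
      (integrable_genGaussianDensity hk hσ) (ae_genGaussianDensity_pos k σ (by omega))).ae_le h,
    fun h => (distOfDensity_indicator_absolutelyContinuous _ hB).ae_le h⟩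

theorem volume_absolutelyContinuous_gaussian {d : ℕ} (hd : 0 < d) {σ : ℝ} (hσ : 0 < σ) :
    (volume : Measure (Input d)) ≪ gaussian d σ := by
  have h := restrict_absolutelyContinuous_distOfDensity_indicator MeasurableSet.univ
    (integrable_genGaussianDensity (d := d) (k := 0) (by omega) hσ)
    (ae_genGaussianDensity_pos 0 σ hd)
  rwa [Measure.restrict_univ, indicator_univ, ← genGaussian, ← gaussian_eq_genGaussian hd] at h

/-- Under concentration the base classifier is almost everywhere correct on the ball whose radius
is given by the gamma quantile. -/
theorem Concentration.ae_eq {d C : ℕ} {σ Pcon : ℝ} {F₀ : Input d → Fin C} {x₀ : Input d}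
    {y₀ : Fin C} (hconc : Concentration σ Pcon F₀ x₀ y₀) (hF₀ : Measurable F₀) (hd : 0 < d)
    (hσ : 0 < σ) (hP : 0 < Pcon) :
    ∀ᵐ ε : Input d, ‖ε‖ ≤ σ * √(2 * gammaCDFInv ((d : ℝ) / 2) Pcon) → F₀ (x₀ + ε) = y₀ := by
  obtain ⟨T, hT, hcond⟩ := hconc
  have hd' : (0 : ℝ) < d := by exact_mod_cast hd
  have hprob : IsProbabilityMeasure (gaussian d σ) := by
    rw [gaussian_eq_genGaussian hd]
    exact isProbabilityMeasure_genGaussian (by omega) hσ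
  have hB := measurableSet_norm_le (d := d) T
  have hT0 : 0 ≤ T := by
    by_contra! hneg
    have : {ε : Input d | ‖ε‖ ≤ T} = ∅ := by
      ext ε
      simpa using hneg.trans_le (norm_nonneg ε)
    rw [this, measureReal_empty] at hT
    exact hP.ne hT
  -- The concentration radius `T` attains the level `Pcon`, so the infimum defining the quantile
  -- cannot exceed `T ^ 2 / (2 * σ ^ 2)`; equality is not needed.
  have hle : σ * √(2 * gammaCDFInv ((d : ℝ) / 2) Pcon) ≤ T := by
    have hq : gammaCDFInv ((d : ℝ) / 2) Pcon ≤ T ^ 2 / (2 * σ ^ 2) := by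
      refine gammaCDFInv_le hP (le_of_eq ?_)
      rw [← hT, gaussian_eq_genGaussian hd, genGaussian_real_closedBall (by omega) hσ hT0]
      simp only [mul_zero, tsub_zero]
      congr 1
      field_simp
    rw [← le_div_iff₀' hσ, sqrt_le_left (by positivity), div_pow]
    calc 2 * gammaCDFInv ((d : ℝ) / 2) Pcon ≤ 2 * (T ^ 2 / (2 * σ ^ 2)) := by gcongr
      _ = T ^ 2 / σ ^ 2 := by field_simp
  have hμB : gaussian d σ {ε | ‖ε‖ ≤ T} ≠ 0 := fun h0 => by
    rw [measureReal_def, h0] at hT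
    exact hP.ne hT
  have hcondprob := cond_isProbabilityMeasure hμB
  have hmeas : MeasurableSet {ε | F₀ (x₀ + ε) = y₀} :=
    (hF₀.comp (measurable_const_add x₀)) (measurableSet_singleton y₀)
  have hae : ∀ᵐ ε ∂(gaussian d σ)[|{ε | ‖ε‖ ≤ T}], F₀ (x₀ + ε) = y₀ :=
    (mem_ae_iff_prob_eq_one hmeas).2 hcond
  have hac : (gaussian d σ).restrict {ε | ‖ε‖ ≤ T} ≪ (gaussian d σ)[|{ε | ‖ε‖ ≤ T}] :=
    Measure.AbsolutelyContinuous.rfl.smul_right (ENNReal.inv_ne_zero.2 (measure_ne_top _ _))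
  have hae' := (ae_restrict_iff' hB).1 (hac.ae_le hae)
  filter_upwards [(volume_absolutelyContinuous_gaussian hd hσ).ae_le hae'] with ε hε h
  exact hε (h.trans hle)

/-! ### The smoothed prediction and the final bound -/

theorem smoothedArgmax_eq_singleton {d C : ℕ} {P : Measure (Input d)} [IsProbabilityMeasure P]
    {F : Input d → Fin C} (hF : Measurable F) {x : Input d} {y : Fin C}
    (h : 1 / 2 < predProb P F x y) : smoothedArgmax P F x = {y} := by
  have hlt : ∀ c, c ≠ y → predProb P F x c < predProb P F x y := by
    intro c hc
    have hmeas : MeasurableSet {ε | F (x + ε) = c} :=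
      (hF.comp (measurable_const_add x)) (measurableSet_singleton c)
    have hdisj : Disjoint {ε | F (x + ε) = y} {ε | F (x + ε) = c} := by
      rw [Set.disjoint_left]
      intro ε h1 h2
      exact hc (Eq.trans (Eq.symm h2) h1)
    have h1 := measureReal_union (μ := P) hdisj hmeas
    have h2 : P.real ({ε | F (x + ε) = y} ∪ {ε | F (x + ε) = c}) ≤ 1 := measureReal_le_one
    unfold predProb at h ⊢
    linarith
  ext c
  refine ⟨fun hc => ?_, ?_⟩
  · by_contra hne
    exact absurd (hc y) (not_le.2 (hlt c hne))
  · rintro rfl c'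
    by_cases hc : c' = c
    · rw [hc]
    · exact (hlt c' hc).le

/-- Since `x + ε = x₀ + ((x - x₀) + ε)`, translation invariance of Lebesgue measure carries the
exceptional null set along, and `P` is absolutely continuous. -/
theorem half_lt_predProb_of_ae_eq_on_ball {d C k : ℕ} {σ T : ℝ} {F : Input d → Fin C}
    {x₀ x : Input d} {y : Fin C} (hk : 2 * k < d) (hσ : 0 < σ)
    (hF : ∀ᵐ ε : Input d, ‖ε‖ ≤ T → F (x₀ + ε) = y)
    (hball : 1 / 2 < (genGaussian d k σ).real {ε | ‖(x - x₀) + ε‖ ≤ T}) :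
    1 / 2 < predProb (genGaussian d k σ) F x y := by
  have := isProbabilityMeasure_genGaussian hk hσ
  refine hball.trans_le (ENNReal.toReal_mono (measure_ne_top _ _) (measure_mono_ae ?_))
  refine (distOfDensity_absolutelyContinuous (genGaussianDensity d k σ)).ae_le ?_
  have hshift := (measurePreserving_add_left volume (x - x₀)).quasiMeasurePreserving.ae hF
  filter_upwards [hshift] with ε hε h
  have := hε h
  rwa [← add_assoc, add_sub_cancel] at this

/-- Only finitely many shapes `m / 2` occur, so one threshold on `d` serves all of them. -/
theorem eventually_median_gap :
    ∀ᶠ d : ℕ in atTop, ∀ m ∈ Finset.Icc (1 : ℕ) 30,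
      160000 / (d : ℝ) < cdf (gammaMeasure ((m : ℝ) / 2) 1) ((m : ℝ) / 2 * 0.9994) - 1 / 2 := by
  refine (Filter.eventually_all_finset _).2 ?_
  intro m hm
  obtain ⟨hm1, hm2⟩ := Finset.mem_Icc.1 hm
  have hm1' : (1 : ℝ) ≤ m := by exact_mod_cast hm1
  have hm2' : (m : ℝ) ≤ 30 := by exact_mod_cast hm2
  have := half_lt_cdf_gammaMeasure (a := (m : ℝ) / 2) (by linarith) (by linarith)
  exact (tendsto_const_div_atTop_nhds_zero_nat (160000 : ℝ)).eventually_lt_const (by linarith)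

end DSRS

theorem theorem2 (Pcon : ℝ) (hPcon0 : 0 < Pcon) (hPcon1 : Pcon < 1) :
    ∃ d₀ : ℕ, ∀ d : ℕ, d₀ ≤ d →
      ∀ (C : ℕ) (σ : ℝ), 0 < σ →
      ∀ (F₀ : DSRS.Input d → Fin C), Measurable F₀ →
      ∀ (x₀ : DSRS.Input d) (y₀ : Fin C), DSRS.Concentration σ Pcon F₀ x₀ y₀ →
      ∀ k : ℕ, (d : ℝ) / 2 - 15 ≤ (k : ℝ) → (k : ℝ) < (d : ℝ) / 2 →
      ∀ (T : ℝ) (P Q : MeasureTheory.Measure (DSRS.Input d)),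
        T = σ * Real.sqrt (2 * DSRS.gammaCDFInv ((d : ℝ) / 2) Pcon) →
        P = DSRS.genGaussian d k σ →
        Q = DSRS.truncGenGaussian d k T σ →
        ENNReal.ofReal (0.02 * σ * Real.sqrt (d : ℝ)) ≤
          DSRS.rDSRS P Q x₀ y₀ (DSRS.predProb P F₀ x₀ y₀) (DSRS.predProb Q F₀ x₀ y₀) := by
  have hquant : ∀ᶠ d : ℕ in Filter.atTop,
      (1 - 0.0001) * ((d : ℝ) / 2) ≤ DSRS.gammaCDFInv ((d : ℝ) / 2) Pcon :=
    (tendsto_natCast_atTop_atTop.atTop_div_const two_pos).eventually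
      (DSRS.eventually_le_gammaCDFInv hPcon0 hPcon1 (by norm_num) (by norm_num))
  obtain ⟨d₀, hd₀⟩ := Filter.eventually_atTop.1
    ((hquant.and DSRS.eventually_median_gap).and (Filter.eventually_gt_atTop 0))
  refine ⟨d₀, fun d hd C σ hσ F₀ hF₀ x₀ y₀ hconc k hk1 hk2 T P Q hT hP hQ => ?_⟩
  obtain ⟨⟨hq, hgap⟩, hdpos⟩ := hd₀ d hd
  subst hP hQ
  have hdpos' : (0 : ℝ) < d := by exact_mod_cast hdpos
  have hk : 2 * k < d := by
    have : ((2 * k : ℕ) : ℝ) < d := by push_cast; linarith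
    exact_mod_cast this
  -- The window `d / 2 - 15 ≤ k < d / 2` is exactly what keeps the shape `(d - 2 * k) / 2` at most
  -- `15`.
  have hm : d - 2 * k ∈ Finset.Icc 1 30 := by
    have : ((d : ℕ) : ℝ) ≤ (2 * k + 30 : ℕ) := by push_cast; linarith
    have : d ≤ 2 * k + 30 := by exact_mod_cast this
    rw [Finset.mem_Icc]
    omega
  have hqpos : 0 < DSRS.gammaCDFInv ((d : ℝ) / 2) Pcon := lt_of_lt_of_le (by positivity) hq
  have hTpos : 0 < T := by rw [hT]; positivity
  have hTsq : 0.9999 * (d * σ ^ 2) ≤ T ^ 2 := by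
    rw [hT, mul_pow, Real.sq_sqrt (by positivity)]
    nlinarith [mul_le_mul_of_nonneg_left hq (sq_nonneg σ)]
  have hmeas : ∀ F : DSRS.Input d → Fin C, Measurable F →
      MeasurableSet {ε | F (x₀ + ε) = y₀} := fun F hF =>
    (hF.comp (measurable_const_add x₀)) (measurableSet_singleton y₀)
  have hQA : DSRS.predProb (DSRS.truncGenGaussian d k T σ) F₀ x₀ y₀ = 1 := by
    refine (DSRS.truncGenGaussian_real_eq_one_iff hk hσ hTpos (hmeas F₀ hF₀)).2 ?_
    rw [hT]
    exact hconc.ae_eq hF₀ hdpos hσ hPcon0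
  refine le_sSup fun F hF _ hFQ x hx => ?_
  have hFae := (DSRS.truncGenGaussian_real_eq_one_iff hk hσ hTpos (hmeas F hF)).1 (hFQ.trans hQA)
  have hδ : ‖x - x₀‖ ≤ 0.02 * σ * √d := by
    rw [edist_dist, ENNReal.ofReal_lt_ofReal_iff_of_nonneg dist_nonneg, dist_eq_norm] at hx
    exact hx.le
  have := DSRS.isProbabilityMeasure_genGaussian hk hσ
  exact DSRS.smoothedArgmax_eq_singleton hF (DSRS.half_lt_predProb_of_ae_eq_on_ball hk hσ hFae
    (DSRS.half_lt_genGaussian_shifted_ball hk hσ (hgap _ hm) hTpos.le hTsq hδ))
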